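/- Let $N$ be a countably infinite set. An almost disjoint family over $N$ is an infinite collection $\mathcal A$ of infinite subsets of $N$ such that $a\cap b$ is finite for all distinct $a,b\in\mathcal A$. Its Isbell–Mrówka space $\Psi(\mathcal A)$ is the disjoint union $N\sqcup\mathcal A$ with the topology generated by the sets $\{n\}$ ($n\in N$) and $\{a\}\cup(a\setminus F)$ ($a\in\mathcal A$, $F\subseteq N$ finite). A topological space $X$ is normal if any two disjoint closed sets have disjoint open neighbourhoods; almost-normal if this holds for any two disjoint sets $F,K$ with $F$ closed and $K$ regular closed ($K=\operatorname{cl}(\operatorname{int}K)$); and semi-normal if for every closed $F$ and every open $U\supseteq F$ there is a regular open set $V$ ($V=\operatorname{int}(\operatorname{cl}V)$) with $F\subseteq V\subseteq U$. The family $\mathcal A$ is called normal, almost-normal or semi-normal if $\Psi(\mathcal A)$ is. A family $\mathcal C$ of subsets of $\omega$ is centered if every finite subfamily has infinite intersection, and $\mathfrak p$ is the least cardinality of a centered family $\mathcal C$ for which there is no infinite $X\subseteq\omega$ with $X\setminus C$ finite for all $C\in\mathcal C$. A Luzin family over $N$ is an almost disjoint family that can be enumerated without repetition as $\{a_\alpha:\alpha<\omega_1\}$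 so that for every $\alpha<\omega_1$ and every finite $F\subseteq N$ the set $\{\beta<\alpha: a_\alpha\cap a_\beta\subseteq F\}$ is finite. 1. Every almost disjoint family $\mathcal A$ over $N$ with $|\mathcal A|<\mathfrak p$ is semi-normal. 2. Every almost disjoint family $\mathcal A$ over $N$ with $|\mathcal A|<\mathfrak p$ is normal if and only if it is almost-normal. 3. If $\mathfrak p>\omega_1$, then no Luzin family over $N$ is almost-normal. -/

import Mathlib

universe u

/-- A regular closed set: a set `F` with `F = cl (int F)` (in particular `F` is closed). -/
def IsRegularClosedSet {X : Type u} [TopologicalSpace X] (F : Set X) : Prop :=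
  F = closure (interior F)

/-- A regular open set: a set `V` with `V = int (cl V)` (in particular `V` is open). -/
def IsRegularOpenSet {X : Type u} [TopologicalSpace X] (V : Set X) : Prop :=
  V = interior (closure V)

/-- A closed set and a regular closed set that are disjoint have disjoint open neighbourhoods. -/
def IsAlmostNormalSpace (X : Type u) [TopologicalSpace X] : Prop :=
  ∀ F K : Set X, IsClosed F → IsRegularClosedSet K → Disjoint F K →
    ∃ U V : Set X, IsOpen U ∧ IsOpen V ∧ F ⊆ U ∧ K ⊆ V ∧ Disjoint U V

/-- Between a closed set and an open set containing it there is a regular open set. -/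
def IsSemiNormalSpace (X : Type u) [TopologicalSpace X] : Prop :=
  ∀ F U : Set X, IsClosed F → IsOpen U → F ⊆ U →
    ∃ V : Set X, IsRegularOpenSet V ∧ F ⊆ V ∧ V ⊆ U

/-- An almost disjoint family over `N`: an infinite collection of infinite subsets of `N`, any two
distinct members of which have finite intersection. -/
structure IsAlmostDisjointFamily {N : Type u} (A : Set (Set N)) : Prop where
  infinite : A.Infinite
  infinite_of_mem : ∀ a ∈ A, a.Infinite
  finite_inter : ∀ a ∈ A, ∀ b ∈ A, a ≠ b → (a ∩ b).Finite

/-- The underlying set of the Isbell-Mrówka space `Ψ(A)`: the disjoint union of `N` and `A`. -/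
def PsiSpace {N : Type u} (A : Set (Set N)) : Type u := N ⊕ A

namespace PsiSpace

/-- The point of `Ψ(A)` given by `n : N`. -/
def ofPoint {N : Type u} {A : Set (Set N)} (n : N) : PsiSpace A := Sum.inl n

/-- The point of `Ψ(A)` given by a member of `A`. -/
def ofMem {N : Type u} {A : Set (Set N)} (a : A) : PsiSpace A := Sum.inr a

/-- The topology generated by the sets `{n}` for `n` in `N`, and `{a} ∪ (a \ F)` for `a` in `A` and
`F` a finite subset of `N`. -/
instance {N : Type u} (A : Set (Set N)) : TopologicalSpace (PsiSpace A) :=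
  TopologicalSpace.generateFrom
    ({U | ∃ n : N, U = {ofPoint n}} ∪
      {U | ∃ (a : A) (F : Set N), F.Finite ∧ U = {ofMem a} ∪ ofPoint '' ((a : Set N) \ F)})

end PsiSpace

/-- Every finite subfamily of `C` has infinite intersection (so each member of `C` is infinite). -/
def IsCenteredFamily (C : Set (Set ℕ)) : Prop :=
  ∀ G : Set (Set ℕ), G ⊆ C → G.Finite → (⋂₀ G).Infinite

/-- `X` is infinite and almost contained in every member of `C`. -/
def IsPseudointersection (X : Set ℕ) (C : Set (Set ℕ)) : Prop :=
  X.Infinite ∧ ∀ c ∈ C, (X \ c).Finite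

/-- The pseudointersection number `𝔭`: the least size of a centered family of subsets of `ℕ` which
has no pseudointersection. -/
noncomputable def pseudointersectionNumber : Cardinal.{0} :=
  sInf {κ | ∃ C : Set (Set ℕ), IsCenteredFamily C ∧ (¬ ∃ X, IsPseudointersection X C) ∧
    Cardinal.mk C = κ}

/-- A Luzin family: an almost disjoint family with an injective enumeration `(a α : α < ω₁)` such
that for each `α < ω₁` and each finite `F ⊆ N` only finitely many `β < α` satisfy
`a α ∩ a β ⊆ F`. -/
def IsLuzinFamily {N : Type u} (A : Set (Set N)) : Prop :=
  IsAlmostDisjointFamily A ∧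
    ∃ a : Set.Iio (Ordinal.omega.{0} 1) → Set N,
      Function.Injective a ∧ Set.range a = A ∧
        ∀ α, ∀ F : Set N, F.Finite → {β | β < α ∧ a α ∩ a β ⊆ F}.Finite

open Set Cardinal

namespace PsiSpace

variable {N : Type u} {A : Set (Set N)}

/-! Below `𝔭`, every subfamily `B` of `A` is weakly separated from the rest: some `X` meets members
of `B` in finite sets and all others in infinite sets (`exists_weak_separation`). Given closed `F ⊆
U` open, take `B` to be the members of `A` lying in `F`; deleting `X` from the `N`-part of `U`
expels every member outside `U` from the hull, and hulls are regular open. Semi-normality turns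
almost-normality into normality, while a pigeonhole argument shows that a Luzin family is never
normal. -/

theorem isOpen_iff {U : Set (PsiSpace A)} :
    IsOpen U ↔ ∀ a : A, ofMem a ∈ U → ((a : Set N) \ ofPoint ⁻¹' U).Finite := by
  constructor
  · intro h
    induction h with
    | basic s hs =>
      intro a ha
      rcases hs with ⟨n, rfl⟩ | ⟨b, F, hF, rfl⟩
      · cases ha
      · rcases ha with ha | ⟨n, -, hn⟩
        · obtain rfl : a = b := Sum.inr_injective ha
          refine hF.subset fun n hn => ?_
          by_contra hnF
          exact hn.2 (Or.inr ⟨n, ⟨hn.1, hnF⟩, rfl⟩)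
        · cases hn
    | univ => simp
    | inter s t _ _ hs ht =>
      intro a ha
      refine ((hs a ha.1).union (ht a ha.2)).subset fun n hn => ?_
      by_cases h : ofPoint n ∈ s
      · exact Or.inr ⟨hn.1, fun h' => hn.2 ⟨h, h'⟩⟩
      · exact Or.inl ⟨hn.1, h⟩
    | sUnion S _ ih =>
      rintro a ⟨s, hs, ha⟩
      exact (ih s hs a ha).subset fun n hn => ⟨hn.1, fun h => hn.2 ⟨s, hs, h⟩⟩
  · intro h
    rw [isOpen_iff_forall_mem_open]
    rintro (n | a) hx
    · exact ⟨{ofPoint n}, Set.singleton_subset_iff.2 hx,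
        TopologicalSpace.isOpen_generateFrom_of_mem (Or.inl ⟨n, rfl⟩), rfl⟩
    · refine ⟨{ofMem a} ∪ ofPoint '' ((a : Set N) \ ((a : Set N) \ ofPoint ⁻¹' U)), ?_,
        TopologicalSpace.isOpen_generateFrom_of_mem (Or.inr ⟨a, _, h a hx, rfl⟩), Or.inl rfl⟩
      rintro _ (rfl | ⟨n, hn, rfl⟩)
      · exact hx
      · by_contra hnU
        exact hn.2 ⟨hn.1, hnU⟩

theorem isClosed_iff {F : Set (PsiSpace A)} :
    IsClosed F ↔ ∀ a : A, ofMem a ∉ F → ((a : Set N) ∩ ofPoint ⁻¹' F).Finite := by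
  rw [← isOpen_compl_iff, isOpen_iff]
  simp only [Set.mem_compl_iff, Set.preimage_compl, Set.sdiff_compl]

/-- The largest open subset of `Ψ(A)` whose points from `N` are those of `M`. -/
def hull (A : Set (Set N)) (M : Set N) : Set (PsiSpace A) :=
  {x | Sum.elim (· ∈ M) (fun a : A => ((a : Set N) \ M).Finite) x}

theorem isOpen_hull (M : Set N) : IsOpen (hull A M) := isOpen_iff.2 fun _ ha => ha

theorem ofPoint_mem_of_mem_closure {U : Set (PsiSpace A)} {n : N}
    (h : ofPoint n ∈ closure U) : ofPoint n ∈ U := by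
  obtain ⟨_, rfl, hx⟩ := mem_closure_iff.1 h {ofPoint n}
    (TopologicalSpace.isOpen_generateFrom_of_mem (Or.inl ⟨n, rfl⟩)) rfl
  exact hx

/-- Points of `N` are isolated, so taking closures adds none of them, and the hull is already the
largest open set with its trace on `N`. -/
theorem isRegularOpenSet_hull (M : Set N) : IsRegularOpenSet (hull A M) := by
  refine subset_antisymm (interior_maximal subset_closure (isOpen_hull M)) ?_
  rintro (n | a) hx
  · exact ofPoint_mem_of_mem_closure (interior_subset hx)
  · exact ((isOpen_iff.1 isOpen_interior) a hx).subset fun n hn =>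
      ⟨hn.1, fun h => hn.2 (ofPoint_mem_of_mem_closure (interior_subset h))⟩

end PsiSpace

theorem exists_pseudointersection {ι E : Type u} [Countable E] [Infinite E] (s : ι → Set E)
    (hι : #ι < Cardinal.lift.{u, 0} pseudointersectionNumber)
    (hs : ∀ t : Finset ι, (⋂ i ∈ t, s i).Infinite) :
    ∃ X : Set E, X.Infinite ∧ ∀ i, (X \ s i).Finite := by
  obtain ⟨_⟩ := nonempty_denumerable E
  let e : E ≃ ℕ := Denumerable.eqv E
  let C : Set (Set ℕ) := Set.range fun i => e.symm ⁻¹' s i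
  have hcard : #C < pseudointersectionNumber := by
    rw [← Cardinal.lift_lt.{0, u}]
    refine lt_of_le_of_lt ?_ hι
    simpa using mk_range_le_lift (f := fun i => e.symm ⁻¹' s i)
  have hcent : IsCenteredFamily C := by
    intro G hG hfin
    classical
    lift G to Finset (Set ℕ) using hfin
    rw [show C = (fun i => e.symm ⁻¹' s i) '' Set.univ from Set.image_univ.symm,
      Finset.subset_set_image_iff] at hG
    obtain ⟨t, -, rfl⟩ := hG
    have := (hs t).image e.injective.injOn
    refine this.mono ?_
    rintro _ ⟨x, hx, rfl⟩
    simpa using hx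
  have : ∃ X, IsPseudointersection X C := by
    by_contra h
    exact notMem_of_lt_csInf' hcard ⟨C, hcent, h, rfl⟩
  obtain ⟨X, hX, hXC⟩ := this
  refine ⟨e.symm '' X, hX.image e.symm.injective.injOn, fun i => ?_⟩
  refine ((hXC _ ⟨i, rfl⟩).image e.symm).subset ?_
  rintro _ ⟨⟨x, hx, rfl⟩, hn⟩
  exact ⟨x, ⟨hx, hn⟩, rfl⟩

/-- Any subfamily of an almost disjoint family of size less than `𝔭` is weakly separated from the
rest of the family. -/
theorem IsAlmostDisjointFamily.exists_weak_separation {N : Type u} [Countable N]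
    {A : Set (Set N)} (hA : IsAlmostDisjointFamily A)
    (hcard : #A < Cardinal.lift.{u, 0} pseudointersectionNumber) (B : Set (Set N)) :
    ∃ X : Set N, (∀ b ∈ A, b ∈ B → (b ∩ X).Finite) ∧ ∀ a ∈ A, a ∉ B → (a ∩ X).Infinite := by
  classical
  have : Infinite A := hA.infinite.to_subtype
  have : Infinite N := by
    obtain ⟨a, ha⟩ := hA.infinite.nonempty
    exact (hA.infinite_of_mem a ha).to_subtype.of_injective _ Subtype.val_injective
  -- The pseudointersection is taken among finite subsets of `N`: almost all of its elements miss a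
  -- given `b ∈ B`, meet a given `a ∉ B`, and omit a given `n`. Its union is the required set.
  let s : A ⊕ N → Set (Finset N) := Sum.elim
    (fun a => if (a : Set N) ∈ B then {f | ∀ x ∈ f, x ∉ (a : Set N)}
      else {f | ∃ x ∈ f, x ∈ (a : Set N)})
    (fun n => {f | n ∉ f})
  have hι : #(A ⊕ N) < Cardinal.lift.{u, 0} pseudointersectionNumber := by
    have h1 : #N ≤ #A := (mk_le_aleph0 (α := N)).trans (aleph0_le_mk A)
    rwa [mk_sum, Cardinal.lift_id, Cardinal.lift_id, add_eq_left (aleph0_le_mk A) h1]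
  obtain ⟨X, hX, hXs⟩ := exists_pseudointersection s hι <| by
    intro t
    let D : Set N := (⋃ a ∈ {a : A | Sum.inl a ∈ t ∧ (a : Set N) ∈ B}, (a : Set N)) ∪
      {n | Sum.inr n ∈ t}
    have hinl : {a : A | Sum.inl a ∈ t}.Finite :=
      t.finite_toSet.preimage Sum.inl_injective.injOn
    have hinr : {n : N | (Sum.inr n : A ⊕ N) ∈ t}.Finite :=
      t.finite_toSet.preimage Sum.inr_injective.injOn
    have hD : ∀ a : A, ¬ (Sum.inl a ∈ t ∧ (a : Set N) ∈ B) → ((a : Set N) \ D).Infinite := by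
      intro a ha
      have hfin : ((a : Set N) ∩ D).Finite := by
        simp only [D, Set.inter_union_distrib_left, Set.inter_iUnion₂]
        refine Set.Finite.union ?_ (hinr.subset Set.inter_subset_right)
        refine Set.Finite.biUnion (hinl.subset fun b hb => hb.1) fun b hb => ?_
        refine hA.finite_inter a a.2 b b.2 fun h => ha ?_
        rw [Subtype.ext h]
        exact hb
      have := (hA.infinite_of_mem a a.2).sdiff hfin
      rwa [Set.sdiff_self_inter] at this
    have hne : ∀ a : A, ∃ x : N, ¬ (Sum.inl a ∈ t ∧ (a : Set N) ∈ B) → x ∈ (a : Set N) \ D := by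
      intro a
      by_cases ha : Sum.inl a ∈ t ∧ (a : Set N) ∈ B
      · exact ⟨Classical.arbitrary N, fun h => absurd ha h⟩
      · obtain ⟨x, hx⟩ := (hD a ha).nonempty
        exact ⟨x, fun _ => hx⟩
    choose g hg using hne
    -- `f₀` meets all requirements in `t`. A member of `A` not mentioned in `t` then supplies
    -- infinitely many points outside `D`, hence infinitely many one-point extensions that still
    -- meet them.
    let f₀ : Finset N := (hinl.toFinset.filter fun a : A => (a : Set N) ∉ B).image g
    obtain ⟨a, ha⟩ := hinl.exists_notMem
    have hinf := (hD a fun h => ha h.1).sdiff f₀.finite_toSet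
    refine Set.infinite_of_injOn_mapsTo (f := fun x => insert x f₀) ?_ ?_ hinf
    · intro x hx y hy hxy
      have : x ∈ insert y f₀ := hxy.subset (Finset.mem_insert_self x f₀)
      exact (Finset.mem_insert.1 this).resolve_right hx.2
    · intro x hx
      have hdisj : ∀ y ∈ insert x f₀, y ∉ D := by
        intro y hy
        rcases Finset.mem_insert.1 hy with rfl | hy
        · exact hx.1.2
        · obtain ⟨b, hb, rfl⟩ := Finset.mem_image.1 hy
          exact (hg b fun h => (Finset.mem_filter.1 hb).2 h.2).2
      refine Set.mem_iInter₂.2 ?_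
      rintro (b | n) hi
      · by_cases hb : (b : Set N) ∈ B
        · simp only [s, Sum.elim_inl, if_pos hb]
          exact fun y hy hyb => hdisj y hy (Or.inl (Set.mem_biUnion (x := b) ⟨hi, hb⟩ hyb))
        · simp only [s, Sum.elim_inl, if_neg hb]
          exact ⟨g b, Finset.mem_insert_of_mem (Finset.mem_image_of_mem g
            (Finset.mem_filter.2 ⟨hinl.mem_toFinset.2 hi, hb⟩)), (hg b fun h => hb h.2).1⟩
      · exact fun hn => hdisj n hn (Or.inr hi)
  refine ⟨{n | ∃ f ∈ X, n ∈ f}, fun b hbA hb => ?_, fun a haA ha hfin => ?_⟩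
  · have h := hXs (Sum.inl ⟨b, hbA⟩)
    simp only [s, Sum.elim_inl, if_pos hb] at h
    refine (h.biUnion fun f _ => f.finite_toSet).subset ?_
    rintro n ⟨hnb, f, hf, hnf⟩
    exact Set.mem_biUnion ⟨hf, fun h => h n hnf hnb⟩ hnf
  · have h := hXs (Sum.inl ⟨a, haA⟩)
    simp only [s, Sum.elim_inl, if_neg ha] at h
    -- Each point lies in only finitely many elements of `X`, so a finite trace on `a` would leave
    -- almost all of them missing `a`.
    have h2 := hfin.biUnion fun n _ => hXs (Sum.inr n)
    obtain ⟨f, hf, hf'⟩ := (hX.sdiff (h.union h2)).nonempty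
    simp only [Set.mem_union, not_or] at hf'
    obtain ⟨n, hnf, hna⟩ : f ∈ {f : Finset N | ∃ x ∈ f, x ∈ a} := by
      by_contra hn
      exact hf'.1 ⟨hf, hn⟩
    exact hf'.2 (Set.mem_biUnion (x := n) ⟨hna, f, hf, hnf⟩ ⟨hf, fun h => h hnf⟩)

open PsiSpace in
theorem IsAlmostDisjointFamily.isSemiNormalSpace {N : Type u} [Countable N]
    {A : Set (Set N)} (hA : IsAlmostDisjointFamily A)
    (hcard : #A < Cardinal.lift.{u, 0} pseudointersectionNumber) :
    IsSemiNormalSpace (PsiSpace A) := by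
  intro F U hF hU hFU
  obtain ⟨X, hXb, hXa⟩ := hA.exists_weak_separation hcard (Subtype.val '' {a : A | ofMem a ∈ F})
  -- Points of `F` are kept even when they lie in `X`; this is harmless, since a member of `A`
  -- outside the closed set `F` meets it in a finite set.
  refine ⟨hull A (ofPoint ⁻¹' U \ (X \ ofPoint ⁻¹' F)), isRegularOpenSet_hull _, ?_, ?_⟩
  · rintro (n | a) hx
    · exact ⟨hFU hx, fun h => h.2 hx⟩
    · refine ((isOpen_iff.1 hU a (hFU hx)).union (hXb a a.2 ⟨a, hx, rfl⟩)).subset fun n hn => ?_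
      by_cases hnU : ofPoint n ∈ U
      · refine Or.inr ⟨hn.1, ?_⟩
        by_contra hnX
        exact hn.2 ⟨hnU, fun h => hnX h.1⟩
      · exact Or.inl ⟨hn.1, hnU⟩
  · rintro (n | a) hx
    · exact hx.1
    · by_contra haU
      have haF : ofMem a ∉ F := fun h => haU (hFU h)
      refine hXa a a.2 ?_ ((Set.Finite.union hx (isClosed_iff.1 hF a haF)).subset fun n hn => ?_)
      · rintro ⟨b, hb, hab⟩
        exact haF (Subtype.ext hab ▸ hb)
      · by_cases hnF : ofPoint n ∈ F
        · exact Or.inr ⟨hn.1, hnF⟩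
        · exact Or.inl ⟨hn.1, fun h => h.2 ⟨hn.2, hnF⟩⟩

theorem IsRegularOpenSet.isRegularClosedSet_compl {X : Type u} [TopologicalSpace X] {V : Set X}
    (hV : IsRegularOpenSet V) : IsRegularClosedSet Vᶜ := by
  rw [IsRegularClosedSet, interior_compl, closure_compl, ← hV]

theorem isAlmostNormalSpace_of_normalSpace {X : Type u} [TopologicalSpace X] [NormalSpace X] :
    IsAlmostNormalSpace X := fun _ _ hF hK hFK =>
  normal_separation hF (hK.symm ▸ isClosed_closure) hFK

theorem IsAlmostNormalSpace.normalSpace {X : Type u} [TopologicalSpace X]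
    (h : IsAlmostNormalSpace X) (hs : IsSemiNormalSpace X) : NormalSpace X := by
  refine ⟨fun F K hF hK hFK => ?_⟩
  obtain ⟨V, hV, hFV, hVK⟩ := hs F Kᶜ hF hK.isOpen_compl hFK.subset_compl_right
  obtain ⟨U, W, hU, hW, hFU, hVW, hUW⟩ := h F Vᶜ hF hV.isRegularClosedSet_compl
    (Set.disjoint_compl_right_iff_subset.2 hFV)
  exact ⟨U, W, hU, hW, hFU, (Set.subset_compl_comm.1 hVK).trans hVW, hUW⟩

theorem Uncountable.exists_uncountable_compl {α : Type*} [Uncountable α] :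
    ∃ S : Set α, ¬ S.Countable ∧ ¬ Sᶜ.Countable := by
  have h : #(α ⊕ α) = #α := by simp
  obtain ⟨e⟩ := Cardinal.eq.1 h
  have hl : ¬ (Set.range fun a : α => e (Sum.inl a)).Countable := fun hc =>
    not_countable (α := α) <| Set.countable_univ_iff.1 <|
      Set.MapsTo.countable_of_injOn (fun x _ => Set.mem_range_self x)
        (e.injective.comp Sum.inl_injective).injOn hc
  have hr : ¬ (Set.range fun a : α => e (Sum.inr a)).Countable := fun hc =>
    not_countable (α := α) <| Set.countable_univ_iff.1 <|
      Set.MapsTo.countable_of_injOn (fun x _ => Set.mem_range_self x)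
        (e.injective.comp Sum.inr_injective).injOn hc
  refine ⟨Set.range fun a : α => e (Sum.inl a), hl, fun hc => hr (hc.mono ?_)⟩
  rintro _ ⟨a, rfl⟩ ⟨b, hb⟩
  exact Sum.inl_ne_inr (e.injective hb)

theorem Set.exists_uncountable_fiber {α β : Type*} [Countable β] {S : Set α}
    (hS : ¬ S.Countable) (f : α → β) : ∃ b, ¬ (S ∩ f ⁻¹' {b}).Countable := by
  by_contra! h
  refine hS ((Set.countable_iUnion h).mono fun x hx => ?_)
  exact Set.mem_iUnion.2 ⟨f x, hx, rfl⟩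

theorem countable_Iic_of_Iio_omega_one (α : Set.Iio (Ordinal.omega.{0} 1)) :
    (Set.Iic α).Countable := by
  have h : (Set.Iic (α : Ordinal)).Countable := by
    rw [← Order.Iio_succ, ← Cardinal.le_aleph0_iff_set_countable, Cardinal.mk_Iio_ordinal,
      Cardinal.lift_le_aleph0, ← Order.lt_succ_iff, Cardinal.succ_aleph0,
      ← lt_omega_iff_card_lt]
    exact (Cardinal.isSuccLimit_omega 1).succ_lt α.2
  exact h.preimage_of_injOn Subtype.val_injective.injOn

open PsiSpace in
-- Separating two uncountable halves leaves finite errors, which are constant on uncountable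
-- subfamilies; so one finite set contains `a α ∩ a β` for infinitely many `β < α`.
theorem IsLuzinFamily.not_normalSpace {N : Type u} [Countable N] {A : Set (Set N)}
    (hA : IsLuzinFamily A) : ¬ NormalSpace (PsiSpace A) := by
  classical
  intro hnormal
  obtain ⟨-, a, hinj, rfl, ha⟩ := hA
  have : Uncountable (Set.Iio (Ordinal.omega.{0} 1)) := by
    rw [← Cardinal.aleph0_lt_mk_iff, Cardinal.mk_Iio_ordinal]
    simp
  obtain ⟨S, hS, hS'⟩ := Uncountable.exists_uncountable_compl
    (α := Set.Iio (Ordinal.omega.{0} 1))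
  let p : Set.Iio (Ordinal.omega.{0} 1) → PsiSpace (Set.range a) := fun i => ofMem ⟨a i, i, rfl⟩
  have hp : Function.Injective p := fun i j h =>
    hinj (congrArg Subtype.val (Sum.inr_injective h))
  have hclosed : ∀ T, IsClosed (p '' T) := fun T => isClosed_iff.2 fun b _ => by
    convert Set.finite_empty
    refine Set.eq_empty_of_forall_notMem ?_
    rintro n ⟨-, i, -, hi⟩
    cases hi
  obtain ⟨U, V, hU, hV, hSU, hSV, hUV⟩ := normal_separation
    (hclosed S) (hclosed Sᶜ) ((Set.disjoint_image_iff hp).2 disjoint_compl_right)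
  have hfinU : ∀ i ∈ S, (a i \ ofPoint ⁻¹' U).Finite := fun i hi =>
    isOpen_iff.1 hU ⟨a i, i, rfl⟩ (hSU ⟨i, hi, rfl⟩)
  have hfinV : ∀ i ∈ Sᶜ, (a i \ ofPoint ⁻¹' V).Finite := fun i hi =>
    isOpen_iff.1 hV ⟨a i, i, rfl⟩ (hSV ⟨i, hi, rfl⟩)
  -- The default `∅` is never used on `S`, by `hfinU`; likewise for `G` and `hfinV`.
  obtain ⟨F, hF⟩ := Set.exists_uncountable_fiber hS fun i =>
    if h : (a i \ ofPoint ⁻¹' U).Finite then h.toFinset else ∅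
  obtain ⟨G, hG⟩ := Set.exists_uncountable_fiber hS' fun i =>
    if h : (a i \ ofPoint ⁻¹' V).Finite then h.toFinset else ∅
  obtain ⟨D, hDG, hDinf, hD⟩ : ∃ D ⊆ Sᶜ ∩ (fun i => if h : (a i \ ofPoint ⁻¹' V).Finite then
      h.toFinset else ∅) ⁻¹' {G}, D.Infinite ∧ D.Countable := by
    let e := Set.Infinite.natEmbedding _ (fun h => hG h.countable)
    exact ⟨Set.range fun n => (e n : Set.Iio (Ordinal.omega.{0} 1)),
      Set.range_subset_iff.2 fun n => (e n).2,
      Set.infinite_range_of_injective (Subtype.val_injective.comp e.injective),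
      Set.countable_range _⟩
  -- The initial segments up to elements of `D` cover only countably many indices, so some `α` in
  -- the fibre of `F` lies above all of `D`.
  obtain ⟨α, hα, hαD⟩ := Set.not_subset.1 fun h =>
    hF ((hD.biUnion fun β _ => countable_Iic_of_Iio_omega_one β).mono h)
  refine hDinf ((ha α (F ∪ G : Finset N) (Finset.finite_toSet _)).subset fun β hβ => ⟨?_, ?_⟩)
  · by_contra h
    exact hαD (Set.mem_biUnion hβ (not_lt.1 h))
  · rintro n ⟨hnα, hnβ⟩
    have hαF := hα.2
    have hβG := (hDG hβ).2
    simp only [Set.mem_preimage, Set.mem_singleton_iff, dif_pos (hfinU α hα.1)] at hαF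
    simp only [Set.mem_preimage, Set.mem_singleton_iff, dif_pos (hfinV β (hDG hβ).1)] at hβG
    simp only [Finset.coe_union, ← hαF, ← hβG, Set.Finite.coe_toFinset]
    by_cases hn : ofPoint n ∈ U
    · exact Or.inr ⟨hnβ, fun h => Set.disjoint_left.1 hUV hn h⟩
    · exact Or.inl ⟨hnα, hn⟩

theorem IsLuzinFamily.mk_eq {N : Type u} {A : Set (Set N)} (hA : IsLuzinFamily A) :
    #A = ℵ₁ := by
  obtain ⟨-, a, hinj, rfl, -⟩ := hA
  rw [← Cardinal.lift_inj.{u, 1}, mk_range_eq_of_injective hinj, Cardinal.mk_Iio_ordinal]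
  simp

theorem corollary5p5 {N : Type u} [Countable N] [Infinite N] :
    (∀ A : Set (Set N), IsAlmostDisjointFamily A →
      Cardinal.mk A < Cardinal.lift.{u, 0} pseudointersectionNumber →
        IsSemiNormalSpace (PsiSpace A)) ∧
    (∀ A : Set (Set N), IsAlmostDisjointFamily A →
      Cardinal.mk A < Cardinal.lift.{u, 0} pseudointersectionNumber →
        (NormalSpace (PsiSpace A) ↔ IsAlmostNormalSpace (PsiSpace A))) ∧
    (Cardinal.aleph.{0} 1 < pseudointersectionNumber →
      ∀ A : Set (Set N), IsLuzinFamily A → ¬ IsAlmostNormalSpace (PsiSpace A)) := by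
  refine ⟨fun A hA h => hA.isSemiNormalSpace h, fun A hA h =>
    ⟨fun _ => isAlmostNormalSpace_of_normalSpace, fun hn => hn.normalSpace (hA.isSemiNormalSpace h)⟩,
    fun h A hA hn => hA.not_normalSpace (hn.normalSpace (hA.1.isSemiNormalSpace ?_))⟩
  rw [hA.mk_eq, ← Cardinal.lift_lt.{0, u}] at *
  simpa using h
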